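/- Proposition 5.1. Fix an integer $k\ge 2$ and $p\in(0,1)$ with $kp>1$. Let $E_0=[0,1]^2$, and let $E_n$ ($n\ge 1$) be the level-$n$ approximations of fractal percolation: divide $[0,1]^2$ into $k^2$ closed squares of side $1/k$, keep each of them with probability $p$, and repeat this in every kept square, all choices being independent; $E_n$ is the union of the kept squares of side $k^{-n}$. For $\theta\in(0,\pi/2)$ let $\Delta$ be the diagonal of $[0,1]^2$ from $(0,0)$ to $(1,1)$, identified with $[0,\sqrt2]$ by arc length. Each line $\{(a,b): a\cos\theta+b\sin\theta=s\}$ that meets $[0,1]^2$ meets $\Delta$ in exactly one point; let $\ell_x^\theta$ be the one through $x\in\Delta$, and let $$y_n^\theta(x)=\frac{\cos\theta+\sin\theta}{\sqrt2}\;p^{-n}\,|\ell_x^\theta\cap E_n|,$$ where $|\cdot|$ is length. This is the density, with respect to arc length on $\Delta$, of the image of the measure $p^{-n}\,\mathrm{Leb}|_{E_n}$ under the projection to $\Delta$ along the lines $\ell_x^\theta$. There is $b\in(0,1)$, depending only on $k$ and $p$, such that almost surely the following holds. The limit $\lim_{m\to\infty}y_m^\theta(x)$ exists for all $\theta\in(0,\pi/2)$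 and all $x\in\Delta$. For every $\delta>0$ the convergence is uniform in $(\theta,x)\in[\delta,\pi/2-\delta]\times\Delta$, and there exist $C_3>0$ and $N_2>0$ such that for all integers $N>N_2$, all $x,y\in\Delta$ with $|x-y|<k^{-N-1}$ and all $\theta\in[\delta,\pi/2-\delta]$, $$\left|\lim_{m\to\infty}y_m^\theta(x)-\lim_{m\to\infty}y_m^\theta(y)\right|<C_3\,b^N.$$ -/

import Mathlib

open MeasureTheory ProbabilityTheory Filter Topology Set

namespace Percolation

/-- Addresses of level `n`: pairs `(i_1 ... i_n, j_1 ... j_n)` of words over `{0, ..., k-1}`. -/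
abbrev Address (k n : ℕ) : Type := (Fin n → Fin k) × (Fin n → Fin k)

/-- The parent of an address: both words lose their last letter. -/
def Address.parent {k n : ℕ} (w : Address k (n + 1)) : Address k n :=
  (fun l => w.1 l.castSucc, fun l => w.2 l.castSucc)

/-- The set of all addresses of positive level (`⟨n, w⟩` has level `n + 1`). -/
abbrev Node (k : ℕ) : Type := (n : ℕ) × Address k (n + 1)

/-- The marks which drive percolation with parameters `k`, `p`: mutually independent events `A w`,
one for each address `w` of positive level, each of probability `p`.  The event `A w` says that
the square `w` is kept if its parent has been kept. -/
structure IsMarking {Ω : Type*} [MeasurableSpace Ω] (P : Measure Ω) (k : ℕ) (p : ℝ)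
    (A : Node k → Set Ω) : Prop where
  measurableSet : ∀ w, MeasurableSet (A w)
  indep : iIndepSet A P
  prob : ∀ w, P (A w) = ENNReal.ofReal p

/-- The random set of retained addresses of level `n`.  The unit square is retained, and an
address of level `n + 1` is retained iff its parent is and its own mark occurs. -/
def retained {Ω : Type*} {k : ℕ} (A : Node k → Set Ω) (ω : Ω) : (n : ℕ) → Set (Address k n)
  | 0 => Set.univ
  | n + 1 => {w | w.parent ∈ retained A ω n ∧ ω ∈ A ⟨n, w⟩}

/-- The closed `k`-adic interval of length `k⁻ⁿ` with address `i`. -/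
def kInterval {k n : ℕ} (i : Fin n → Fin k) : Set ℝ :=
  Icc (∑ l : Fin n, ((i l : ℕ) : ℝ) * ((k : ℝ) ^ ((l : ℕ) + 1))⁻¹)
    (((k : ℝ) ^ n)⁻¹ + ∑ l : Fin n, ((i l : ℕ) : ℝ) * ((k : ℝ) ^ ((l : ℕ) + 1))⁻¹)

/-- The closed `k`-adic square with a given address. -/
def kSquare {k n : ℕ} (w : Address k n) : Set (ℝ × ℝ) :=
  kInterval w.1 ×ˢ kInterval w.2

/-- The level `n` approximation of the percolation fractal: the union of the retained squares. -/
def approx {Ω : Type*} {k : ℕ} (A : Node k → Set Ω) (ω : Ω) (n : ℕ) : Set (ℝ × ℝ) :=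
  ⋃ w ∈ retained A ω n, kSquare w

/-- The point with (signed) parameter `t` of the line `{(a, b) | a cos θ + b sin θ = s}`, which is
parametrized by arc length. -/
noncomputable def linePoint (θ s t : ℝ) : ℝ × ℝ :=
  (s * Real.cos θ - t * Real.sin θ, s * Real.sin θ + t * Real.cos θ)

/-- The density `y_n^θ(s)` of the image of the measure `p⁻ⁿ Leb|_{E_n}` under
`(a, b) ↦ a cos θ + b sin θ`, that is `p⁻ⁿ` times the length of the part of `E_n` on the line
`{a cos θ + b sin θ = s}`. -/
noncomputable def density {Ω : Type*} {k : ℕ} (p : ℝ) (A : Node k → Set Ω) (ω : Ω)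
    (n : ℕ) (θ s : ℝ) : ℝ :=
  (p ^ n)⁻¹ * (volume {t : ℝ | linePoint θ s t ∈ approx A ω n}).toReal

/-- The common range: the diagonal `{(a, a) | 0 ≤ a ≤ 1}` of the unit square, in terms of its arc
length coordinate, in which `x` stands for the point `(x / √2, x / √2)`.  For `0 < θ < π / 2` each
line `{a cos θ + b sin θ = s}` that meets the unit square meets this diagonal in one point. -/
def commonRange : Set ℝ := Icc 0 (Real.sqrt 2)

/-- The value of `a cos θ + b sin θ` at the point of the diagonal with arc length coordinate `1`.
The line `{a cos θ + b sin θ = s}` meets the diagonal at `x` iff `s = diagScale θ * x`. -/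
noncomputable def diagScale (θ : ℝ) : ℝ := (Real.cos θ + Real.sin θ) / Real.sqrt 2

/-- The density at `x` (with respect to arc length on the diagonal) of the image of
`p⁻ⁿ Leb|_{E_n}` under the projection along the lines `{a cos θ + b sin θ = s}` to the diagonal.
The factor `diagScale θ` is the Jacobian of the change of coordinate `s = diagScale θ * x`. -/
noncomputable def diagDensity {Ω : Type*} {k : ℕ} (p : ℝ) (A : Node k → Set Ω) (ω : Ω)
    (n : ℕ) (θ x : ℝ) : ℝ :=
  diagScale θ * density p A ω n θ (diagScale θ * x)

end Percolation

/-! With `l = cos θ / (cos θ + sin θ)` and `z = x / √2`, the density is `(√2)⁻¹ * slantDensity`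
(`diagDensity_eq`). For fixed `(l, z)` this is a martingale in `n`. Given level `n`, its increment
is a sum of independent centred terms weighted by chords of length at most `2 k^(-n-1)`, whose total
is `p^n f` for the current value `f`. Hoeffding's inequality bounds the probability of an increment
of size at least `c (1 + f)` by `2 exp(-p^(n+2) c^2 k^(n+1))` (`measureReal_slantDensity_le`). For
`c = b^n` with `b^2 k p > 1` this is doubly exponentially small, so it survives a union bound over a
net of mesh `k^(-4n)`, and Borel–Cantelli applies (`ae_eventually_net`).

The rest is deterministic. Away from `l = 0, 1` the level-`n` density is Lipschitz with constant of
order `k^(3n)`, so the net controls all lines up to an error of order `k^(-n) ≤ b^n`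
(`exists_abs_step_le_mul`). The steps `C b^n (1 + f)` have a bounded cumulative effect, so the
densities stay bounded and converge geometrically (`exists_abs_step_le`,
`exists_slantDensity_limit`). Comparing the limit with level `N / 4` gives the modulus of continuity
(`abs_limit_sub_le`), at the cost of replacing `b` by its fourth root. -/

namespace Percolation

/-! ### Geometry of `k`-adic intervals and squares -/

/-- The left endpoint of the `k`-adic interval with address `i`. -/
noncomputable def leftEnd {k n : ℕ} (i : Fin n → Fin k) : ℝ :=
  ∑ l : Fin n, ((i l : ℕ) : ℝ) * ((k : ℝ) ^ ((l : ℕ) + 1))⁻¹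

lemma kInterval_eq_Icc {k n : ℕ} (i : Fin n → Fin k) :
    kInterval i = Icc (leftEnd i) (((k : ℝ) ^ n)⁻¹ + leftEnd i) := rfl

lemma leftEnd_succ {k n : ℕ} (i : Fin (n + 1) → Fin k) :
    leftEnd i = leftEnd (fun l => i l.castSucc) +
      ((i (Fin.last n) : ℕ) : ℝ) * ((k : ℝ) ^ (n + 1))⁻¹ := by
  simp [leftEnd, Fin.sum_univ_castSucc]

lemma inv_pow_eq_mul_inv_pow_succ {k : ℕ} (hk : 0 < k) (n : ℕ) :
    ((k : ℝ) ^ n)⁻¹ = k * ((k : ℝ) ^ (n + 1))⁻¹ := by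
  have : (k : ℝ) ≠ 0 := by positivity
  rw [pow_succ]
  field_simp

lemma kInterval_subset_init {k n : ℕ} (hk : 0 < k) (i : Fin (n + 1) → Fin k) :
    kInterval i ⊆ kInterval (fun l => i l.castSucc) := by
  rw [kInterval_eq_Icc, kInterval_eq_Icc, leftEnd_succ, inv_pow_eq_mul_inv_pow_succ hk n]
  have h : 0 < ((k : ℝ) ^ (n + 1))⁻¹ := by positivity
  have h1 : ((i (Fin.last n) : ℕ) : ℝ) + 1 ≤ k := by
    exact_mod_cast (i (Fin.last n)).2
  apply Icc_subset_Icc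
  · have : 0 ≤ ((i (Fin.last n) : ℕ) : ℝ) * ((k : ℝ) ^ (n + 1))⁻¹ := by positivity
    linarith
  · nlinarith

lemma exists_mem_kInterval_snoc {k n : ℕ} (hk : 0 < k) (v : Fin n → Fin k) {x : ℝ}
    (hx : x ∈ kInterval v) :
    ∃ i : Fin (n + 1) → Fin k, (fun l => i l.castSucc) = v ∧ x ∈ kInterval i := by
  rw [kInterval_eq_Icc, mem_Icc, inv_pow_eq_mul_inv_pow_succ hk] at hx
  have h : 0 < ((k : ℝ) ^ (n + 1))⁻¹ := by positivity
  set h' := ((k : ℝ) ^ (n + 1))⁻¹ with hh'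
  set y := (x - leftEnd v) / h' with hy
  have hxy : x = leftEnd v + y * h' := by rw [hy]; field_simp; ring
  have hy0 : 0 ≤ y := div_nonneg (by linarith) h.le
  have hyk : y ≤ k := by rw [hy, div_le_iff₀ h]; linarith
  obtain ⟨c, hck, hc1, hc2⟩ : ∃ c : ℕ, c < k ∧ (c : ℝ) ≤ y ∧ y ≤ c + 1 := by
    by_cases hlt : ⌊y⌋₊ < k
    · exact ⟨_, hlt, Nat.floor_le hy0, (Nat.lt_floor_add_one y).le⟩
    -- Here `x` is the right endpoint, which belongs to the last child.
    · have : (k : ℝ) ≤ y := (Nat.le_floor_iff hy0).1 (not_lt.1 hlt)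
      refine ⟨k - 1, by omega, ?_, ?_⟩ <;> rw [Nat.cast_sub (by omega)] <;> push_cast <;> linarith
  refine ⟨Fin.snoc (α := fun _ => Fin k) v ⟨c, hck⟩, by ext l; simp, ?_⟩
  rw [kInterval_eq_Icc, leftEnd_succ, ← hh']
  simp only [Fin.snoc_castSucc, Fin.snoc_last]
  constructor <;> nlinarith

lemma kInterval_inter_subsingleton {k : ℕ} (hk : 0 < k) : ∀ {n : ℕ} {i j : Fin n → Fin k},
    i ≠ j → (kInterval i ∩ kInterval j).Subsingleton
  | 0, i, j, hij => (hij (Subsingleton.elim i j)).elim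
  | n + 1, i, j, hij => by
    by_cases hp : (fun l : Fin n => i l.castSucc) = fun l => j l.castSucc
    · have hl : (i (Fin.last n) : ℕ) ≠ j (Fin.last n) := by
        intro h
        apply hij
        ext l
        refine Fin.lastCases ?_ (fun l => ?_) l
        · exact h
        · exact congrArg Fin.val (congrFun hp l)
      have h : 0 < ((k : ℝ) ^ (n + 1))⁻¹ := by positivity
      rintro x ⟨hx1, hx2⟩ y ⟨hy1, hy2⟩
      rw [kInterval_eq_Icc, leftEnd_succ, mem_Icc] at hx1 hx2 hy1 hy2
      rw [← hp] at hx2 hy2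
      rcases lt_or_gt_of_ne hl with hl | hl
      · have : ((i (Fin.last n) : ℕ) : ℝ) + 1 ≤ (j (Fin.last n) : ℕ) := by exact_mod_cast hl
        nlinarith
      · have : ((j (Fin.last n) : ℕ) : ℝ) + 1 ≤ (i (Fin.last n) : ℕ) := by exact_mod_cast hl
        nlinarith
    · exact (kInterval_inter_subsingleton hk hp).anti
        (inter_subset_inter (kInterval_subset_init hk i) (kInterval_subset_init hk j))

lemma kInterval_subset_unit {k : ℕ} (hk : 0 < k) : ∀ {n : ℕ} (i : Fin n → Fin k),
    kInterval i ⊆ Icc 0 1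
  | 0, i => by simp [kInterval]
  | _ + 1, i => (kInterval_subset_init hk i).trans (kInterval_subset_unit hk _)

/-- The union of the children of the squares in `S` is the union of the squares in `S`. -/
lemma biUnion_kSquare_children {k n : ℕ} (hk : 0 < k) (S : Set (Address k n)) :
    ⋃ w ∈ {w : Address k (n + 1) | w.parent ∈ S}, kSquare w = ⋃ v ∈ S, kSquare v := by
  ext ⟨x, y⟩
  simp only [mem_iUnion, mem_ofPred_eq, exists_prop]
  constructor
  · rintro ⟨w, hw, hx, hy⟩
    exact ⟨_, hw, kInterval_subset_init hk _ hx, kInterval_subset_init hk _ hy⟩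
  · rintro ⟨v, hv, hx, hy⟩
    obtain ⟨i, hi, hxi⟩ := exists_mem_kInterval_snoc hk _ hx
    obtain ⟨j, hj, hyj⟩ := exists_mem_kInterval_snoc hk _ hy
    refine ⟨(i, j), ?_, hxi, hyj⟩
    have : Address.parent (i, j) = v := Prod.ext hi hj
    rwa [this]

/-! ### Chords of squares and their dependence on the line -/

/-- The line `{(a, b) | l a + (1 - l) b = z}`, parametrized by `u`. -/
def slantPoint (l z u : ℝ) : ℝ × ℝ := (z + (1 - l) * u, z - l * u)

/-- The size, in the parameter of `slantPoint`, of the part of the line in a square. -/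
noncomputable def chord {k n : ℕ} (w : Address k n) (l z : ℝ) : ℝ :=
  volume.real {u : ℝ | slantPoint l z u ∈ kSquare w}

/-- The total size of the parts of the line in the squares of `S`. -/
noncomputable def chordSum {k n : ℕ} (S : Set (Address k n)) (l z : ℝ) : ℝ :=
  ∑ w, S.indicator (fun w => chord w l z) w

section Chord

variable {k n : ℕ} {l z : ℝ}

lemma setOf_slantPoint_mem_kSquare (w : Address k n) (hl0 : 0 < l) (hl1 : l < 1) :
    {u : ℝ | slantPoint l z u ∈ kSquare w} =
      Icc (max ((leftEnd w.1 - z) * (1 - l)⁻¹) ((z - leftEnd w.2 - ((k : ℝ) ^ n)⁻¹) * l⁻¹))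
        (min ((leftEnd w.1 + ((k : ℝ) ^ n)⁻¹ - z) * (1 - l)⁻¹) ((z - leftEnd w.2) * l⁻¹)) := by
  have hl : 0 < 1 - l := by linarith
  ext u
  simp only [slantPoint, kSquare, kInterval_eq_Icc, mem_ofPred_eq, mem_prod, mem_Icc, max_le_iff,
    le_min_iff, ← div_eq_mul_inv, div_le_iff₀ hl, le_div_iff₀ hl, div_le_iff₀ hl0, le_div_iff₀ hl0]
  constructor
  · rintro ⟨⟨h1, h2⟩, h3, h4⟩
    refine ⟨⟨?_, ?_⟩, ?_, ?_⟩ <;> linarith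
  · rintro ⟨⟨h1, h2⟩, h3, h4⟩
    refine ⟨⟨?_, ?_⟩, ?_, ?_⟩ <;> linarith

lemma chord_eq (w : Address k n) (hl0 : 0 < l) (hl1 : l < 1) :
    chord w l z =
      max (min ((leftEnd w.1 + ((k : ℝ) ^ n)⁻¹ - z) * (1 - l)⁻¹) ((z - leftEnd w.2) * l⁻¹) -
        max ((leftEnd w.1 - z) * (1 - l)⁻¹) ((z - leftEnd w.2 - ((k : ℝ) ^ n)⁻¹) * l⁻¹)) 0 := by
  rw [chord, setOf_slantPoint_mem_kSquare w hl0 hl1, Real.volume_real_Icc]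

lemma chord_nonneg (w : Address k n) : 0 ≤ chord w l z := measureReal_nonneg

/-- One of `l`, `1 - l` is at least `1 / 2`, and the corresponding coordinate alone confines `u`.
The bound is uniform up to `l = 0, 1`, so the concentration estimate needs no margin there. -/
lemma chord_le (w : Address k n) (hl0 : 0 < l) (hl1 : l < 1) :
    chord w l z ≤ 2 * ((k : ℝ) ^ n)⁻¹ := by
  rw [chord_eq w hl0 hl1]
  have h : 0 ≤ ((k : ℝ) ^ n)⁻¹ := by positivity
  refine max_le ?_ (by positivity)
  rcases le_total l (1 / 2) with hl | hl
  · have h2 : (1 - l)⁻¹ ≤ 2 := by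
      rw [inv_le_comm₀ (by linarith) (by norm_num)]; linarith
    calc _ ≤ (leftEnd w.1 + ((k : ℝ) ^ n)⁻¹ - z) * (1 - l)⁻¹ - (leftEnd w.1 - z) * (1 - l)⁻¹ :=
          sub_le_sub (min_le_left _ _) (le_max_left _ _)
      _ = (1 - l)⁻¹ * ((k : ℝ) ^ n)⁻¹ := by ring
      _ ≤ _ := by gcongr
  · have h2 : l⁻¹ ≤ 2 := by
      rw [inv_le_comm₀ (by linarith) (by norm_num)]; linarith
    calc _ ≤ (z - leftEnd w.2) * l⁻¹ - (z - leftEnd w.2 - ((k : ℝ) ^ n)⁻¹) * l⁻¹ :=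
          sub_le_sub (min_le_right _ _) (le_max_right _ _)
      _ = l⁻¹ * ((k : ℝ) ^ n)⁻¹ := by ring
      _ ≤ _ := by gcongr

lemma aedisjoint_slantPoint (hk : 0 < k) (hl0 : 0 < l) (hl1 : l < 1) {w w' : Address k n}
    (hw : w ≠ w') :
    AEDisjoint volume {u : ℝ | slantPoint l z u ∈ kSquare w}
      {u : ℝ | slantPoint l z u ∈ kSquare w'} := by
  have hl : 0 < 1 - l := by linarith
  apply Set.Subsingleton.measure_zero
  rintro u ⟨⟨hu1, hu2⟩, hu3, hu4⟩ v ⟨⟨hv1, hv2⟩, hv3, hv4⟩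
  by_cases h : w.1 = w'.1
  · have h' : w.2 ≠ w'.2 := fun h' => hw (Prod.ext h h')
    have := kInterval_inter_subsingleton hk h' ⟨hu2, hu4⟩ ⟨hv2, hv4⟩
    simp only [slantPoint] at this
    exact mul_left_cancel₀ hl0.ne' (by linarith)
  · have := kInterval_inter_subsingleton hk h ⟨hu1, hu3⟩ ⟨hv1, hv3⟩
    simp only [slantPoint] at this
    exact mul_left_cancel₀ hl.ne' (by linarith)

lemma volume_real_biUnion_kSquare (hk : 0 < k) (hl0 : 0 < l) (hl1 : l < 1)
    (S : Set (Address k n)) :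
    volume.real {u : ℝ | slantPoint l z u ∈ ⋃ w ∈ S, kSquare w} = chordSum S l z := by
  classical
  have h1 : {u : ℝ | slantPoint l z u ∈ ⋃ w ∈ S, kSquare w} =
      ⋃ w ∈ S.toFinset, {u : ℝ | slantPoint l z u ∈ kSquare w} := by
    ext u; simp
  rw [h1, measureReal_def, measure_biUnion_finset₀, ENNReal.toReal_sum, chordSum,
    ← Finset.sum_filter_add_sum_filter_not Finset.univ (fun w => w ∈ S),
    Finset.sum_eq_zero (s := Finset.univ.filter (fun w => w ∉ S)), add_zero]
  · refine Finset.sum_congr (by ext; simp) fun w hw => ?_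
    rw [indicator_of_mem (by simpa using hw), chord, measureReal_def]
  · intro w hw
    rw [indicator_of_notMem (by simpa using hw)]
  · intro w _
    rw [setOf_slantPoint_mem_kSquare w hl0 hl1]
    exact measure_Icc_lt_top.ne
  · intro w _ w' _ hw
    exact aedisjoint_slantPoint hk hl0 hl1 hw
  · intro w _
    rw [setOf_slantPoint_mem_kSquare w hl0 hl1]
    exact measurableSet_Icc.nullMeasurableSet

/-- Subdivision preserves length; this is what makes the normalized densities a martingale. -/
lemma chordSum_children (hk : 0 < k) (hl0 : 0 < l) (hl1 : l < 1) (S : Set (Address k n)) :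
    chordSum {w : Address k (n + 1) | w.parent ∈ S} l z = chordSum S l z := by
  rw [← volume_real_biUnion_kSquare hk hl0 hl1, ← volume_real_biUnion_kSquare hk hl0 hl1,
    biUnion_kSquare_children hk]

lemma chordSum_nonneg (S : Set (Address k n)) : 0 ≤ chordSum S l z :=
  Finset.sum_nonneg fun _ _ => indicator_nonneg (fun _ _ => chord_nonneg _) _

lemma card_address : Fintype.card (Address k n) = k ^ (2 * n) := by
  simp [Address, two_mul, pow_add]

lemma chordSum_le (hk : 0 < k) (hl0 : 0 < l) (hl1 : l < 1) (S : Set (Address k n)) :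
    chordSum S l z ≤ 2 * (k : ℝ) ^ n := by
  have hk' : (0 : ℝ) < k := by exact_mod_cast hk
  calc chordSum S l z ≤ ∑ _w : Address k n, 2 * ((k : ℝ) ^ n)⁻¹ := by
        refine Finset.sum_le_sum fun w _ => ?_
        exact (indicator_le_self' (fun _ _ => chord_nonneg _) w).trans (chord_le w hl0 hl1)
    _ = 2 * (k : ℝ) ^ n := by
        rw [Finset.sum_const, Finset.card_univ, card_address, nsmul_eq_mul, two_mul n, pow_add]
        push_cast
        field_simp

lemma abs_mul_inv_sub_le {ε a z z' m m' d : ℝ} (hε : 0 < ε) (hε1 : ε ≤ 1) (hm : ε ≤ m)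
    (hm' : ε ≤ m') (ha : a ∈ Icc (0 : ℝ) 1) (hz' : z' ∈ Icc (0 : ℝ) 1)
    (hmd : |m - m'| ≤ d) (hzd : |z - z'| ≤ d) :
    |(a - z) * m⁻¹ - (a - z') * m'⁻¹| ≤ 2 * d / ε ^ 2 := by
  have hm0 : 0 < m := hε.trans_le hm
  have hm0' : 0 < m' := hε.trans_le hm'
  have hd : 0 ≤ d := (abs_nonneg _).trans hmd
  have e : (a - z) * m⁻¹ - (a - z') * m'⁻¹ =
      (z' - z) * m⁻¹ + (a - z') * ((m' - m) * (m⁻¹ * m'⁻¹)) := by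
    field_simp; ring
  have hi : m⁻¹ ≤ ε⁻¹ := by gcongr
  have hi' : m'⁻¹ ≤ ε⁻¹ := by gcongr
  have h1 : |(z' - z) * m⁻¹| ≤ d * (ε⁻¹ * ε⁻¹) := by
    rw [abs_mul, abs_of_pos (inv_pos.2 hm0), abs_sub_comm]
    refine mul_le_mul hzd (hi.trans ?_) (by positivity) hd
    have : 1 ≤ ε⁻¹ := one_le_inv₀ hε |>.2 hε1
    nlinarith
  have h2 : |(a - z') * ((m' - m) * (m⁻¹ * m'⁻¹))| ≤ 1 * (d * (ε⁻¹ * ε⁻¹)) := by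
    rw [abs_mul, abs_mul (m' - m), abs_of_pos (show 0 < m⁻¹ * m'⁻¹ by positivity), abs_sub_comm m']
    refine mul_le_mul ?_ ?_ (by positivity) zero_le_one
    · rw [abs_le]; constructor <;> linarith [ha.1, ha.2, hz'.1, hz'.2]
    · gcongr
  rw [e]
  refine (abs_add_le _ _).trans ((add_le_add h1 h2).trans_eq ?_)
  field_simp; ring

lemma abs_chord_sub_le (hk : 0 < k) {ε l' z' d : ℝ} (hε : 0 < ε) (hl : l ∈ Icc ε (1 - ε))
    (hl' : l' ∈ Icc ε (1 - ε)) (hz' : z' ∈ Icc (0 : ℝ) 1)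
    (hld : |l - l'| ≤ d) (hzd : |z - z'| ≤ d) (w : Address k n) :
    |chord w l z - chord w l' z'| ≤ 4 * d / ε ^ 2 := by
  obtain ⟨h1, h2⟩ := hl
  obtain ⟨h3, h4⟩ := hl'
  have hmem : ∀ i : Fin n → Fin k, leftEnd i ∈ Icc (0 : ℝ) 1 ∧
      leftEnd i + ((k : ℝ) ^ n)⁻¹ ∈ Icc (0 : ℝ) 1 := by
    intro i
    have hh : 0 ≤ ((k : ℝ) ^ n)⁻¹ := by positivity
    refine ⟨kInterval_subset_unit hk i ?_, kInterval_subset_unit hk i ?_⟩ <;>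
    · rw [kInterval_eq_Icc]; constructor <;> linarith
  have hld' : |(1 - l) - (1 - l')| ≤ d := by
    rwa [sub_sub_sub_cancel_left, abs_sub_comm]
  have key1 : ∀ a ∈ Icc (0 : ℝ) 1, |(a - z) * (1 - l)⁻¹ - (a - z') * (1 - l')⁻¹| ≤ 2 * d / ε ^ 2 :=
    fun a ha => abs_mul_inv_sub_le hε (by linarith) (by linarith) (by linarith) ha hz' hld' hzd
  have key2 : ∀ a ∈ Icc (0 : ℝ) 1, |(z - a) * l⁻¹ - (z' - a) * l'⁻¹| ≤ 2 * d / ε ^ 2 := by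
    intro a ha
    have := abs_mul_inv_sub_le hε (by linarith) h1 h3 ha hz' hld hzd
    rwa [← abs_neg, show -((z - a) * l⁻¹ - (z' - a) * l'⁻¹) = (a - z) * l⁻¹ - (a - z') * l'⁻¹ by ring]
  rw [chord_eq w (by linarith) (by linarith), chord_eq w (by linarith) (by linarith)]
  have a1 := key1 _ (hmem w.1).2
  have a2 := key2 _ (hmem w.2).1
  have a3 := key1 _ (hmem w.1).1
  have a4 := key2 _ (hmem w.2).2
  simp only [← sub_sub] at a4
  refine (abs_max_sub_max_le_abs _ _ _).trans ?_
  rw [sub_sub_sub_comm]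
  refine (abs_sub _ _).trans ?_
  have b1 := (abs_min_sub_min_le_max _ _ _ _).trans (max_le a1 a2)
  have b2 := (abs_max_sub_max_le_max _ _ _ _).trans (max_le a3 a4)
  calc _ ≤ 2 * d / ε ^ 2 + 2 * d / ε ^ 2 := add_le_add b1 b2
    _ = _ := by ring

/-- All `k^(2n)` squares are counted, whether or not the line meets them. The exponential loss is
harmless, since the mesh of the net can be any power of `k^(-n)`. -/
lemma abs_chordSum_sub_le (hk : 0 < k) {ε l' z' d : ℝ} (hε : 0 < ε) (hl : l ∈ Icc ε (1 - ε))
    (hl' : l' ∈ Icc ε (1 - ε)) (hz' : z' ∈ Icc (0 : ℝ) 1)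
    (hld : |l - l'| ≤ d) (hzd : |z - z'| ≤ d) (S : Set (Address k n)) :
    |chordSum S l z - chordSum S l' z'| ≤ (k : ℝ) ^ (2 * n) * (4 * d / ε ^ 2) := by
  have hd : 0 ≤ d := (abs_nonneg _).trans hld
  rw [chordSum, chordSum, ← Finset.sum_sub_distrib]
  refine (Finset.abs_sum_le_sum_abs _ _).trans ?_
  calc _ ≤ ∑ _w : Address k n, 4 * d / ε ^ 2 := by
        refine Finset.sum_le_sum fun w _ => ?_
        by_cases hw : w ∈ S
        · simpa [hw] using abs_chord_sub_le hk hε hl hl' hz' hld hzd w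
        · simp [hw]; positivity
    _ = _ := by
        rw [Finset.sum_const, Finset.card_univ, card_address, nsmul_eq_mul]
        push_cast
        ring

end Chord

/-! ### Densities, past and present marks, and the increment formula -/

/-- The density `y_n` of the projection along the lines `l a + (1 - l) b = z`, up to a constant
factor. -/
noncomputable def slantDensity {Ω : Type*} {k : ℕ} (p : ℝ) (A : Node k → Set Ω) (ω : Ω)
    (n : ℕ) (l z : ℝ) : ℝ :=
  (p ^ n)⁻¹ * chordSum (retained A ω n) l z

/-- The centred indicator of the mark `w`. -/
noncomputable def centredMark {Ω : Type*} {k : ℕ} (p : ℝ) (A : Node k → Set Ω) (w : Node k)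
    (ω : Ω) : ℝ :=
  (A w).indicator (fun _ => (1 : ℝ)) ω - p

lemma _root_.ProbabilityTheory.HasSubgaussianMGF.mono {Ω : Type*} [MeasurableSpace Ω]
    {P : Measure Ω} {X : Ω → ℝ} {c c' : NNReal} (h : HasSubgaussianMGF X c P) (hc : c ≤ c') :
    HasSubgaussianMGF X c' P where
  integrable_exp_mul := h.integrable_exp_mul
  mgf_le t := (h.mgf_le t).trans (by gcongr)

section Retained

variable {Ω : Type*} {k : ℕ} {p : ℝ} {A : Node k → Set Ω}

/-- The information contained in the marks of the levels `1, ..., n`. -/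
@[reducible]
def pastMarks (A : Node k → Set Ω) (n : ℕ) : MeasurableSpace Ω :=
  ⨆ w ∈ {w : Node k | w.1 < n}, MeasurableSpace.generateFrom {A w}

/-- The information contained in the marks of level `n + 1`. -/
@[reducible]
def presentMarks (A : Node k → Set Ω) (n : ℕ) : MeasurableSpace Ω :=
  ⨆ w ∈ {w : Node k | w.1 = n}, MeasurableSpace.generateFrom {A w}

lemma measurableSet_mem_retained (n : ℕ) (v : Address k n) :
    MeasurableSet[pastMarks A n] {ω | v ∈ retained A ω n} := by
  induction n with
  | zero => simp [retained]
  | succ n ih =>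
    have hle : pastMarks A n ≤ pastMarks A (n + 1) :=
      biSup_mono fun w (hw : w.1 < n) => hw.trans (Nat.lt_succ_self n)
    refine MeasurableSet.inter (hle _ (ih v.parent)) ?_
    have : MeasurableSpace.generateFrom {A ⟨n, v⟩} ≤ pastMarks A (n + 1) :=
      le_biSup (fun w => MeasurableSpace.generateFrom {A w})
        (show (⟨n, v⟩ : Node k) ∈ {w : Node k | w.1 < n + 1} from Nat.lt_succ_self n)
    exact this _ (MeasurableSpace.measurableSet_generateFrom rfl)

lemma measurableSet_retained_eq (n : ℕ) (S : Set (Address k n)) :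
    MeasurableSet[pastMarks A n] {ω | retained A ω n = S} := by
  have : {ω | retained A ω n = S} = ⋂ v, {ω | v ∈ retained A ω n ↔ v ∈ S} := by
    ext ω
    simp [Set.ext_iff]
  rw [this]
  refine MeasurableSet.iInter fun v => ?_
  by_cases hv : v ∈ S
  · simpa only [hv, iff_true] using measurableSet_mem_retained n v
  · have := (measurableSet_mem_retained (A := A) n v).compl
    rw [compl_ofPred] at this
    simpa only [hv, iff_false] using this

lemma measurable_centredMark (n : ℕ) (w : Address k (n + 1)) :
    Measurable[presentMarks A n] (centredMark p A ⟨n, w⟩) := by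
  have : MeasurableSpace.generateFrom {A ⟨n, w⟩} ≤ presentMarks A n :=
    le_biSup (fun w => MeasurableSpace.generateFrom {A w})
      (show (⟨n, w⟩ : Node k) ∈ {w : Node k | w.1 = n} from rfl)
  let _ := presentMarks A n
  exact (measurable_const.indicator
    (this _ (MeasurableSpace.measurableSet_generateFrom rfl))).sub_const _

/-- The coefficients depend only on past marks and the centred factors only on present ones, so
Hoeffding applies conditionally. -/
lemma slantDensity_succ_sub (hk : 0 < k) (hp : 0 < p) {l z : ℝ} (hl0 : 0 < l) (hl1 : l < 1)
    (n : ℕ) (ω : Ω) :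
    slantDensity p A ω (n + 1) l z - slantDensity p A ω n l z = (p ^ (n + 1))⁻¹ *
      ∑ w : Address k (n + 1), {w : Address k (n + 1) | w.parent ∈ retained A ω n}.indicator
        (fun w => chord w l z) w * centredMark p A ⟨n, w⟩ ω := by
  have h1 : chordSum (retained A ω (n + 1)) l z = ∑ w : Address k (n + 1),
      {w : Address k (n + 1) | w.parent ∈ retained A ω n}.indicator (fun w => chord w l z) w *
        (A ⟨n, w⟩).indicator (fun _ => (1 : ℝ)) ω := by
    refine Finset.sum_congr rfl fun w _ => ?_
    by_cases h1 : w.parent ∈ retained A ω n <;> by_cases h2 : ω ∈ A ⟨n, w⟩ <;>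
      simp [retained, h1, h2]
  have h2 : slantDensity p A ω n l z = (p ^ (n + 1))⁻¹ *
      (chordSum {w : Address k (n + 1) | w.parent ∈ retained A ω n} l z * p) := by
    rw [chordSum_children hk hl0 hl1, slantDensity, pow_succ]
    field_simp
  rw [h2, slantDensity, h1, ← mul_sub, chordSum, Finset.sum_mul, ← Finset.sum_sub_distrib]
  simp only [centredMark, mul_sub]

lemma slantDensity_nonneg (hp : 0 < p) {l z : ℝ} (n : ℕ) (ω : Ω) :
    0 ≤ slantDensity p A ω n l z :=
  mul_nonneg (by positivity) (chordSum_nonneg _)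

end Retained

/-! ### Concentration of one increment -/

section Probability

variable {Ω : Type*} [MeasurableSpace Ω] {P : Measure Ω} {k : ℕ} {p : ℝ}
  {A : Node k → Set Ω}

lemma IsMarking.hasSubgaussianMGF [IsProbabilityMeasure P]
    (h : IsMarking P k p A) (hp : 0 ≤ p) (w : Node k) :
    HasSubgaussianMGF (centredMark p A w) (1 / 4) P := by
  have hm : Measurable ((A w).indicator (fun _ => (1 : ℝ))) :=
    measurable_const.indicator (h.measurableSet w)
  have := hasSubgaussianMGF_of_mem_Icc (μ := P) (a := 0) (b := 1) hm.aemeasurable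
    (ae_of_all _ fun ω => by by_cases hω : ω ∈ A w <;> simp [hω])
  have hint : P[(A w).indicator (fun _ => (1 : ℝ))] = p := by
    rw [integral_indicator_const _ (h.measurableSet w), measureReal_def, h.prob w,
      ENNReal.toReal_ofReal hp, smul_eq_mul, mul_one]
  rw [hint] at this
  refine this.mono (le_of_eq ?_)
  ext
  norm_num

lemma IsMarking.iIndepFun_centredMark (h : IsMarking P k p A) :
    iIndepFun (centredMark p A) P :=
  (h.indep.iIndepFun_indicator (β := ℝ)).comp (fun _ x => x - p) fun _ => by fun_prop

/-- Two-sided Hoeffding: each term has variance proxy `a w ^ 2 / 4`, and the tail bound is applied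
to the sum and to its negative. -/
lemma IsMarking.measureReal_le_abs_sum [IsProbabilityMeasure P]
    (h : IsMarking P k p A) (hp : 0 ≤ p) {n : ℕ}
    (a : Address k (n + 1) → ℝ) {V ε : ℝ} (hV : ∑ w, a w ^ 2 ≤ 4 * V) (hε : 0 ≤ ε) :
    P.real {ω | ε ≤ |∑ w, a w * centredMark p A ⟨n, w⟩ ω|} ≤ 2 * Real.exp (-ε ^ 2 / (2 * V)) := by
  have hV0 : 0 ≤ V := by
    have : 0 ≤ ∑ w, a w ^ 2 := Finset.sum_nonneg fun _ _ => sq_nonneg _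
    linarith
  have hind : iIndepFun (fun (w : Address k (n + 1)) ω => a w * centredMark p A ⟨n, w⟩ ω) P :=
    (h.iIndepFun_centredMark.precomp (g := fun w : Address k (n + 1) => (⟨n, w⟩ : Node k))
      (sigma_mk_injective (β := fun n => Address k (n + 1)))).comp (fun w x => a w * x) fun _ => by fun_prop
  have hscale (w : Address k (n + 1)) :
      HasSubgaussianMGF (fun ω => a w * centredMark p A ⟨n, w⟩ ω)
        (Real.toNNReal (a w ^ 2) * (1 / 4)) P := by
    rw [Real.toNNReal_of_nonneg (sq_nonneg _)]
    exact (h.hasSubgaussianMGF hp ⟨n, w⟩).const_mul (a w)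
  have hsum := (HasSubgaussianMGF.sum_of_iIndepFun hind (s := Finset.univ)
    fun w _ => hscale w).mono (c' := Real.toNNReal V) (by
      rw [← NNReal.coe_le_coe, Real.coe_toNNReal _ hV0]
      push_cast
      simp only [Real.coe_toNNReal _ (sq_nonneg _)]
      rw [← Finset.sum_mul]
      linarith)
  have h1 := hsum.measure_ge_le hε
  have h2 := hsum.neg.measure_ge_le hε
  simp only [Real.coe_toNNReal _ hV0, Pi.neg_apply] at h1 h2
  calc _ ≤ P.real ({ω | ε ≤ ∑ w, a w * centredMark p A ⟨n, w⟩ ω} ∪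
        {ω | ε ≤ -∑ w, a w * centredMark p A ⟨n, w⟩ ω}) := by
        refine measureReal_mono fun ω hω => ?_
        exact le_abs.1 (mem_ofPred_eq ▸ hω)
    _ ≤ _ := (measureReal_union_le _ _).trans (by linarith)

lemma IsMarking.indep_past_present (h : IsMarking P k p A) (n : ℕ) :
    Indep (pastMarks A n) (presentMarks A n) P := by
  refine indep_iSup_of_disjoint (fun w => ?_) h.indep ?_
  · exact MeasurableSpace.generateFrom_le (by simpa using h.measurableSet w)
  · rw [Set.disjoint_left]
    intro w h1 h2
    exact absurd h2 (ne_of_lt h1)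

/-- Given the retained squares of level `n`, the density at level `n + 1` is concentrated around
the density at level `n`. -/
lemma IsMarking.measureReal_slantDensity_le [IsProbabilityMeasure P]
    (h : IsMarking P k p A) (hk : 0 < k) (hp : 0 < p)
    {l z c : ℝ} (hl0 : 0 < l) (hl1 : l < 1) (hc : 0 ≤ c) (n : ℕ) :
    P.real {ω | c * (1 + slantDensity p A ω n l z) ≤
        |slantDensity p A ω (n + 1) l z - slantDensity p A ω n l z|} ≤
      2 * Real.exp (-(p ^ (n + 2) * c ^ 2 * (k : ℝ) ^ (n + 1))) := by
  have hk' : (0 : ℝ) < k := by exact_mod_cast hk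
  let a (S : Set (Address k n)) (w : Address k (n + 1)) : ℝ :=
    {w : Address k (n + 1) | w.parent ∈ S}.indicator (fun w => chord w l z) w
  let f (S : Set (Address k n)) : ℝ := (p ^ n)⁻¹ * chordSum S l z
  let B (S : Set (Address k n)) : Set Ω :=
    {ω | p ^ (n + 1) * c * (1 + f S) ≤ |∑ w, a S w * centredMark p A ⟨n, w⟩ ω|}
  have hf (S : Set (Address k n)) : 0 ≤ f S := mul_nonneg (by positivity) (chordSum_nonneg _)
  have ha0 (S : Set (Address k n)) (w : Address k (n + 1)) : 0 ≤ a S w :=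
    indicator_nonneg (fun _ _ => chord_nonneg _) _
  have hB (S : Set (Address k n)) :
      P.real (B S) ≤ 2 * Real.exp (-(p ^ (n + 2) * c ^ 2 * (k : ℝ) ^ (n + 1))) := by
    -- The sum of squares is at most the largest chord times the chord sum, hence linear in `1 + f
    -- S`. The squared threshold is quadratic in it, so the exponent keeps a factor `1 + f S ≥ 1`,
    -- which is dropped to get a bound uniform in `S`.
    have hV : ∑ w, a S w ^ 2 ≤ 4 * (p ^ n * (1 + f S) * ((k : ℝ) ^ (n + 1))⁻¹ / 2) := by
      calc ∑ w, a S w ^ 2 ≤ ∑ w, 2 * ((k : ℝ) ^ (n + 1))⁻¹ * a S w := by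
            refine Finset.sum_le_sum fun w _ => ?_
            rw [sq]
            refine mul_le_mul_of_nonneg_right ?_ (ha0 S w)
            exact (indicator_le_self' (fun _ _ => chord_nonneg _) w).trans (chord_le w hl0 hl1)
        _ = 2 * ((k : ℝ) ^ (n + 1))⁻¹ * chordSum S l z := by
            rw [← Finset.mul_sum, ← chordSum_children hk hl0 hl1 S, chordSum]
        _ = 2 * ((k : ℝ) ^ (n + 1))⁻¹ * (p ^ n * f S) := by
            congr 1; simp only [f]; field_simp
        _ ≤ 2 * ((k : ℝ) ^ (n + 1))⁻¹ * (p ^ n * (1 + f S)) := by gcongr; linarith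
        _ = _ := by ring
    refine (h.measureReal_le_abs_sum hp.le (a S) hV ?_).trans ?_
    · have := hf S; positivity
    · have h1 : 0 < 1 + f S := by linarith [hf S]
      have e : -(p ^ (n + 1) * c * (1 + f S)) ^ 2 /
          (2 * (p ^ n * (1 + f S) * ((k : ℝ) ^ (n + 1))⁻¹ / 2)) =
          -(p ^ (n + 2) * c ^ 2 * (k : ℝ) ^ (n + 1)) * (1 + f S) := by
        field_simp
        ring
      rw [e]
      have h3 : 0 ≤ p ^ (n + 2) * c ^ 2 * (k : ℝ) ^ (n + 1) := by positivity
      gcongr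
      nlinarith [hf S]
  have hpast (S : Set (Address k n)) := measurableSet_retained_eq (A := A) n S
  have hpres (S : Set (Address k n)) : MeasurableSet[presentMarks A n] (B S) := by
    let _ := presentMarks A n
    refine measurableSet_le measurable_const (Measurable.abs ?_)
    exact Finset.measurable_sum _ fun w _ => (measurable_centredMark n w).const_mul _
  have hle : pastMarks A n ≤ ‹MeasurableSpace Ω› :=
    iSup₂_le fun w _ => MeasurableSpace.generateFrom_le (by simpa using h.measurableSet w)
  have hsum : ∑ S : Set (Address k n), P.real {ω | retained A ω n = S} = 1 := by
    rw [← measureReal_biUnion_finset]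
    · rw [show ⋃ S ∈ Finset.univ, {ω | retained A ω n = S} = univ by ext; simp]
      simp
    · intro S _ T _ hST
      rw [Function.onFun, Set.disjoint_left]
      intro ω h1 h2
      exact hST (h1.symm.trans h2)
    · exact fun S _ => hle _ (hpast S)
  -- Conditioning on the past is a finite partition by the value `S` of the retained set; `B S` is
  -- an event of the present marks, independent of it.
  calc _ ≤ P.real (⋃ S : Set (Address k n), {ω | retained A ω n = S} ∩ B S) := by
        refine measureReal_mono fun ω hω => ?_
        refine mem_iUnion.2 ⟨retained A ω n, rfl, ?_⟩
        simp only [mem_ofPred_eq, slantDensity_succ_sub hk hp hl0 hl1] at hω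
        rw [abs_mul, abs_of_pos (by positivity), inv_mul_eq_div, le_div_iff₀ (by positivity)] at hω
        exact le_trans (le_of_eq (by simp only [f, slantDensity]; ring)) hω
    _ ≤ ∑ S : Set (Address k n), P.real ({ω | retained A ω n = S} ∩ B S) :=
        measureReal_iUnion_fintype_le _
    _ = ∑ S : Set (Address k n), P.real {ω | retained A ω n = S} * P.real (B S) := by
        refine Finset.sum_congr rfl fun S _ => ?_
        simp only [measureReal_def]
        rw [(Indep_iff _ _ P).1 (h.indep_past_present n) _ _ (hpast S) (hpres S),
          ENNReal.toReal_mul]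
    _ ≤ ∑ S : Set (Address k n), P.real {ω | retained A ω n = S} *
          (2 * Real.exp (-(p ^ (n + 2) * c ^ 2 * (k : ℝ) ^ (n + 1)))) := by
        gcongr with S
        exact hB S
    _ = _ := by rw [← Finset.sum_mul, hsum, one_mul]

end Probability

/-! ### Union bound over a net and Borel–Cantelli -/

/-- Since `exp x ≥ x ^ j / j!`, a `j` with `r ^ j > M` gives a geometric majorant. -/
lemma summable_pow_mul_exp_neg_pow {r c M : ℝ} (hr : 1 < r) (hc : 0 < c) (hM : 0 ≤ M) :
    Summable fun n : ℕ => M ^ n * Real.exp (-(c * r ^ n)) := by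
  obtain ⟨j, hj⟩ := pow_unbounded_of_one_lt M hr
  have hr0 : 0 < r := by linarith
  have hg : Summable fun n : ℕ => (j.factorial : ℝ) / c ^ j * (M / r ^ j) ^ n := by
    refine (summable_geometric_of_lt_one (by positivity) ?_).mul_left _
    rw [div_lt_one (by positivity)]
    exact hj
  refine hg.of_nonneg_of_le (fun n => by positivity) fun n => ?_
  have hx : 0 < c * r ^ n := by positivity
  have h1 := Real.pow_div_factorial_le_exp _ hx.le j
  rw [div_le_iff₀ (by positivity)] at h1
  have h2 : Real.exp (-(c * r ^ n)) ≤ (j.factorial : ℝ) / (c * r ^ n) ^ j := by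
    rw [Real.exp_neg, le_div_iff₀ (by positivity), inv_mul_le_iff₀ (Real.exp_pos _)]
    exact h1
  calc _ ≤ M ^ n * ((j.factorial : ℝ) / (c * r ^ n) ^ j) := by gcongr
    _ = _ := by
      rw [mul_pow, div_pow, ← pow_mul, ← pow_mul, mul_comm n j]
      field_simp

/-- Almost surely, at all large levels, the densities along all lines of a fine net change little
from one level to the next. -/
lemma IsMarking.ae_eventually_net {Ω : Type*} [MeasurableSpace Ω] {P : Measure Ω}
    [IsProbabilityMeasure P] {k : ℕ} {p : ℝ} {A : Node k → Set Ω} (h : IsMarking P k p A)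
    (hk : 0 < k) (hp : 0 < p) {b : ℝ} (hb : 0 < b) (hbkp : 1 < b ^ 2 * (k * p)) {K : ℕ}
    (hK : 0 < K) :
    ∀ᵐ ω ∂P, ∀ᶠ n : ℕ in atTop, ∀ i j : ℕ, 0 < i → i < K ^ n → j ≤ K ^ n →
      |slantDensity p A ω (n + 1) (i / (K : ℝ) ^ n) (j / (K : ℝ) ^ n) -
        slantDensity p A ω n (i / (K : ℝ) ^ n) (j / (K : ℝ) ^ n)| <
      b ^ n * (1 + slantDensity p A ω n (i / (K : ℝ) ^ n) (j / (K : ℝ) ^ n)) := by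
  have hk' : (0 : ℝ) < k := by exact_mod_cast hk
  have hK' : (0 : ℝ) < K := by exact_mod_cast hK
  let E (n i j : ℕ) : Set Ω := {ω | b ^ n *
      (1 + slantDensity p A ω n (i / (K : ℝ) ^ n) (j / (K : ℝ) ^ n)) ≤
    |slantDensity p A ω (n + 1) (i / (K : ℝ) ^ n) (j / (K : ℝ) ^ n) -
        slantDensity p A ω n (i / (K : ℝ) ^ n) (j / (K : ℝ) ^ n)|}
  let B (n : ℕ) : Set Ω :=
    ⋃ q ∈ Finset.Ioo 0 (K ^ n) ×ˢ Finset.range (K ^ n + 1), E n q.1 q.2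
  have hE (n i j : ℕ) (hi : 0 < i) (hiK : i < K ^ n) :
      P.real (E n i j) ≤ 2 * Real.exp (-(p ^ 2 * k * (b ^ 2 * (k * p)) ^ n)) := by
    have hi' : (0 : ℝ) < i := by exact_mod_cast hi
    have hiK' : (i : ℝ) < (K : ℝ) ^ n := by exact_mod_cast hiK
    -- With `c = b ^ n` the exponent becomes `p ^ 2 * k * (b ^ 2 * (k * p)) ^ n`, which grows
    -- geometrically.
    refine (h.measureReal_slantDensity_le hk hp (by positivity)
      ((div_lt_one (by positivity)).2 hiK') (by positivity) n).trans (le_of_eq ?_)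
    congr 3
    ring
  have hB (n : ℕ) : P.real (B n) ≤
      4 * (((K : ℝ) ^ 2) ^ n * Real.exp (-(p ^ 2 * k * (b ^ 2 * (k * p)) ^ n))) := by
    have h1 : (1 : ℝ) ≤ (K : ℝ) ^ n := by exact_mod_cast Nat.one_le_pow n K hK
    refine (measureReal_biUnion_finset_le _ _).trans ((Finset.sum_le_card_nsmul _ _
      (2 * Real.exp (-(p ^ 2 * k * (b ^ 2 * (k * p)) ^ n))) ?_).trans ?_)
    · intro q hq
      simp only [Finset.mem_product, Finset.mem_Ioo] at hq
      exact hE n _ _ hq.1.1 hq.1.2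
    · have h2 : ((K ^ n - 0 - 1 : ℕ) : ℝ) ≤ (K : ℝ) ^ n := by
        exact_mod_cast (Nat.sub_le _ _).trans (Nat.sub_le _ _)
      rw [nsmul_eq_mul, Finset.card_product, Nat.card_Ioo, Finset.card_range]
      push_cast
      calc _ ≤ (K : ℝ) ^ n * ((K : ℝ) ^ n + (K : ℝ) ^ n) *
            (2 * Real.exp (-(p ^ 2 * k * (b ^ 2 * (k * p)) ^ n))) := by gcongr
        _ = _ := by ring
  have hsum : Summable fun n : ℕ =>
      4 * (((K : ℝ) ^ 2) ^ n * Real.exp (-(p ^ 2 * k * (b ^ 2 * (k * p)) ^ n))) :=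
    (summable_pow_mul_exp_neg_pow hbkp (by positivity) (by positivity)).mul_left 4
  have htop : ∑' n, P (B n) ≠ ⊤ := by
    refine ne_top_of_le_ne_top hsum.tsum_ofReal_ne_top (ENNReal.tsum_le_tsum fun n => ?_)
    rw [← ofReal_measureReal (measure_ne_top P (B n))]
    exact ENNReal.ofReal_le_ofReal (hB n)
  filter_upwards [ae_eventually_notMem htop] with ω hω
  filter_upwards [hω] with n hn i j hi hiK hj
  by_contra hcon
  refine hn (mem_biUnion (x := (i, j)) ?_ (not_lt.1 hcon))
  simp [hi, hiK, Nat.lt_succ_of_le hj]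

/-! ### From the net to all lines, convergence, and continuity of the limit -/

section Deterministic

variable {Ω : Type*} {k : ℕ} {p : ℝ} {A : Node k → Set Ω} {ω : Ω}

lemma slantDensity_le (hk : 0 < k) (hp : 0 < p) {l z : ℝ} (hl0 : 0 < l) (hl1 : l < 1) (n : ℕ) :
    slantDensity p A ω n l z ≤ (p ^ n)⁻¹ * (2 * (k : ℝ) ^ n) :=
  mul_le_mul_of_nonneg_left (chordSum_le hk hl0 hl1 _) (by positivity)

/-- The normalization costs `(p ^ n)⁻¹ ≤ k ^ n`, by `k p > 1`, on top of the `k ^ (2 * n)` from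
counting squares. -/
lemma abs_slantDensity_sub_le (hk : 0 < k) (hp : 0 < p) (hkp : 1 < k * p) {ε l z l' z' d : ℝ}
    (hε : 0 < ε) (hl : l ∈ Icc ε (1 - ε)) (hl' : l' ∈ Icc ε (1 - ε)) (hz' : z' ∈ Icc (0 : ℝ) 1)
    (hld : |l - l'| ≤ d) (hzd : |z - z'| ≤ d) (n : ℕ) :
    |slantDensity p A ω n l z - slantDensity p A ω n l' z'| ≤
      (k : ℝ) ^ (3 * n) * (4 * d / ε ^ 2) := by
  have hd : 0 ≤ d := (abs_nonneg _).trans hld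
  rw [slantDensity, slantDensity, ← mul_sub, abs_mul, abs_of_pos (by positivity)]
  have h1 : (p ^ n)⁻¹ ≤ (k : ℝ) ^ n := by
    rw [inv_le_iff_one_le_mul₀ (by positivity), ← mul_pow]
    exact one_le_pow₀ hkp.le
  calc _ ≤ (k : ℝ) ^ n * ((k : ℝ) ^ (2 * n) * (4 * d / ε ^ 2)) := by
        gcongr
        exact abs_chordSum_sub_le hk hε hl hl' hz' hld hzd _
    _ = _ := by ring

lemma abs_sub_floor_div_le {x M : ℝ} (hx : 0 ≤ x) (hM : 0 < M) :
    |x - ⌊x * M⌋₊ / M| ≤ M⁻¹ := by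
  have h1 := Nat.floor_le (mul_nonneg hx hM.le)
  have h2 := (Nat.lt_floor_add_one (x * M)).le
  have e : x - ⌊x * M⌋₊ / M = (x * M - ⌊x * M⌋₊) * M⁻¹ := by field_simp
  rw [e, abs_mul, abs_of_nonneg (by linarith : 0 ≤ x * M - ⌊x * M⌋₊),
    abs_of_pos (inv_pos.2 hM)]
  exact mul_le_of_le_one_left (inv_pos.2 hM).le (by linarith)

lemma floor_div_le {x M : ℝ} (hx : 0 ≤ x) (hM : 0 < M) : (⌊x * M⌋₊ : ℝ) / M ≤ x :=
  (div_le_iff₀ hM).2 (Nat.floor_le (mul_nonneg hx hM.le))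

/-- Both parameters are rounded down to the net. The mesh `k^(-4n)` beats the Lipschitz constants of
levels `n` and `n + 1`, leaving `R * b ^ n`. -/
lemma exists_abs_step_le_mul (hk : 2 ≤ k) (hp : 0 < p) (hkp : 1 < k * p) {b : ℝ} (hb1 : b ≤ 1)
    (hbk : (k : ℝ)⁻¹ ≤ b)
    (hnet : ∀ᶠ n : ℕ in atTop, ∀ i j : ℕ, 0 < i → i < (k ^ 4) ^ n → j ≤ (k ^ 4) ^ n →
      |slantDensity p A ω (n + 1) (i / ((k ^ 4 : ℕ) : ℝ) ^ n) (j / ((k ^ 4 : ℕ) : ℝ) ^ n) -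
        slantDensity p A ω n (i / ((k ^ 4 : ℕ) : ℝ) ^ n) (j / ((k ^ 4 : ℕ) : ℝ) ^ n)| <
      b ^ n * (1 + slantDensity p A ω n (i / ((k ^ 4 : ℕ) : ℝ) ^ n) (j / ((k ^ 4 : ℕ) : ℝ) ^ n)))
    {ε : ℝ} (hε : 0 < ε) :
    ∃ C : ℝ, 0 ≤ C ∧ ∃ n₀ : ℕ, ∀ n ≥ n₀, ∀ l ∈ Icc ε (1 - ε), ∀ z ∈ Icc (0 : ℝ) 1,
      |slantDensity p A ω (n + 1) l z - slantDensity p A ω n l z| ≤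
        C * b ^ n * (1 + slantDensity p A ω n l z) := by
  have hk0 : 0 < k := by omega
  have hk' : (2 : ℝ) ≤ k := by exact_mod_cast hk
  have hb0 : 0 < b := lt_of_lt_of_le (by positivity) hbk
  -- Rounding `l` down may leave `[ε, 1 - ε]`, but for such `n` not `[ε / 2, 1 - ε / 2]`.
  have hlim : ∀ᶠ n : ℕ in atTop, (((k : ℝ) ^ 4) ^ n)⁻¹ < ε / 2 := by
    have := (tendsto_pow_atTop_nhds_zero_of_lt_one (r := ((k : ℝ) ^ 4)⁻¹) (by positivity)
      (inv_lt_one_of_one_lt₀ (one_lt_pow₀ (by linarith) (by norm_num)))).eventually_lt_const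
      (half_pos hε)
    simpa only [inv_pow] using this
  obtain ⟨n₀, hn₀⟩ := eventually_atTop.1 (hnet.and hlim)
  set R : ℝ := 16 * (k : ℝ) ^ 3 / ε ^ 2 with hR
  have hR0 : 0 ≤ R := by positivity
  -- The `1` is the net estimate; two `R` come from the Lipschitz errors at the two levels, the
  -- third from replacing `g` by `f + R` in the net bound.
  refine ⟨1 + 3 * R, by positivity, n₀, fun n hn l hl z hz => ?_⟩
  obtain ⟨hnet, hd⟩ := hn₀ n hn
  push_cast at hnet
  set M : ℝ := ((k : ℝ) ^ 4) ^ n with hM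
  have hM0 : 0 < M := by positivity
  have hl0 : 0 ≤ l := hε.le.trans hl.1
  have hld := abs_sub_floor_div_le hl0 hM0
  have hzd := abs_sub_floor_div_le hz.1 hM0
  have hll := floor_div_le hl0 hM0
  have hzl := floor_div_le hz.1 hM0
  set i := ⌊l * M⌋₊
  set j := ⌊z * M⌋₊
  have hl' : (i : ℝ) / M ∈ Icc (ε / 2) (1 - ε / 2) := by
    have := (abs_le.1 hld).2
    constructor <;> linarith [hl.1, hl.2]
  have hz' : (j : ℝ) / M ∈ Icc (0 : ℝ) 1 := ⟨by positivity, hzl.trans hz.2⟩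
  have hi0 : 0 < i := by
    have : 0 < (i : ℝ) / M := lt_of_lt_of_le (by positivity) hl'.1
    have : (0 : ℝ) < i := (div_pos_iff_of_pos_right hM0).1 this
    exact_mod_cast this
  have hi1 : i < (k ^ 4) ^ n := by
    have : (i : ℝ) / M < 1 := by linarith [hl'.2]
    have : (i : ℝ) < M := (div_lt_one hM0).1 this
    rw [hM] at this
    exact_mod_cast this
  have hj1 : j ≤ (k ^ 4) ^ n := by
    have : (j : ℝ) ≤ M := (div_le_one hM0).1 hz'.2
    rw [hM] at this
    exact_mod_cast this
  have hstep := (hnet i j hi0 hi1 hj1).le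
  have hlε : l ∈ Icc (ε / 2) (1 - ε / 2) := by constructor <;> linarith [hl.1, hl.2]
  have hkb : (k : ℝ) ^ (3 * n + 3) * (4 * M⁻¹ / (ε / 2) ^ 2) ≤ R * b ^ n := by
    have e : (k : ℝ) ^ (3 * n + 3) * (4 * M⁻¹ / (ε / 2) ^ 2) = R * ((k : ℝ)⁻¹) ^ n := by
      rw [hM, hR, pow_add, inv_pow, ← pow_mul, show 4 * n = 3 * n + n by ring, pow_add]
      field_simp
      norm_num
    rw [e]
    gcongr
  have hlip1 := (abs_slantDensity_sub_le (A := A) (ω := ω) hk0 hp hkp (half_pos hε) hlε hl' hz'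
    hld hzd (n + 1)).trans hkb
  have hlip0 : |slantDensity p A ω n l z - slantDensity p A ω n (i / M) (j / M)| ≤ R * b ^ n := by
    refine (abs_slantDensity_sub_le hk0 hp hkp (half_pos hε) hlε hl' hz' hld hzd n).trans
      (le_trans ?_ hkb)
    gcongr
    · linarith
    · omega
  have hf := slantDensity_nonneg (A := A) hp (l := l) (z := z) n ω
  set f := slantDensity p A ω n l z
  set f₁ := slantDensity p A ω (n + 1) l z
  set g := slantDensity p A ω n (i / M) (j / M)
  set g₁ := slantDensity p A ω (n + 1) (i / M) (j / M)
  have hbn0 : 0 < b ^ n := by positivity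
  have hbn1 : b ^ n ≤ 1 := pow_le_one₀ hb0.le hb1
  have hg : g ≤ f + R := by
    have := (abs_le.1 hlip0).1
    nlinarith
  have h3 : b ^ n * (1 + g) ≤ b ^ n * (1 + (f + R)) := by gcongr
  have h4 : |f₁ - f| ≤ R * b ^ n + b ^ n * (1 + (f + R)) + R * b ^ n := by
    rw [abs_le] at *
    constructor <;> linarith
  have h5 : 0 ≤ R * b ^ n * f := by positivity
  nlinarith

/-- A discrete Gronwall argument: `1 + f` grows by a factor at most `1 + C b^n ≤ exp (C b^n)` per
step, starting from the trivial bound at level `n₀`. -/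
lemma exists_abs_step_le (hk : 2 ≤ k) (hp : 0 < p) {b : ℝ} (hb0 : 0 < b) (hb1 : b < 1)
    {ε : ℝ} (hε : 0 < ε) {C : ℝ} (hC : 0 ≤ C) {n₀ : ℕ}
    (hstep : ∀ n ≥ n₀, ∀ l ∈ Icc ε (1 - ε), ∀ z ∈ Icc (0 : ℝ) 1,
      |slantDensity p A ω (n + 1) l z - slantDensity p A ω n l z| ≤
        C * b ^ n * (1 + slantDensity p A ω n l z)) :
    ∃ C' : ℝ, 0 ≤ C' ∧ ∀ n ≥ n₀, ∀ l ∈ Icc ε (1 - ε), ∀ z ∈ Icc (0 : ℝ) 1,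
      |slantDensity p A ω (n + 1) l z - slantDensity p A ω n l z| ≤ C' * b ^ n := by
  have hk0 : 0 < k := by omega
  refine ⟨C * ((1 + (p ^ n₀)⁻¹ * (2 * (k : ℝ) ^ n₀)) * Real.exp (C * (1 - b)⁻¹)), by positivity,
    fun n hn l hl z hz => ?_⟩
  have hpre : ∀ n ≥ n₀, 1 + slantDensity p A ω n l z ≤
      (1 + (p ^ n₀)⁻¹ * (2 * (k : ℝ) ^ n₀)) * Real.exp (C * ∑ j ∈ Finset.range n, b ^ j) := by
    intro n hn
    induction n, hn using Nat.le_induction with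
    | base =>
      have h1 : slantDensity p A ω n₀ l z ≤ _ :=
        slantDensity_le hk0 hp (by linarith [hl.1]) (by linarith [hl.2]) n₀
      have h2 : 1 ≤ Real.exp (C * ∑ j ∈ Finset.range n₀, b ^ j) :=
        Real.one_le_exp (by positivity)
      refine le_trans ?_ (le_mul_of_one_le_right (by positivity) h2)
      linarith
    | succ n hn ih =>
      have h0 := slantDensity_nonneg (A := A) hp (l := l) (z := z) n ω
      have h1 := (abs_le.1 (hstep n hn l hl z hz)).2
      rw [Finset.sum_range_succ, mul_add, Real.exp_add, ← mul_assoc]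
      calc _ ≤ (1 + slantDensity p A ω n l z) * (C * b ^ n + 1) := by linarith
        _ ≤ _ := by
          gcongr
          exact Real.add_one_le_exp _
  have hgeo : ∑ j ∈ Finset.range n, b ^ j ≤ (1 - b)⁻¹ := by
    rw [← tsum_geometric_of_lt_one hb0.le hb1]
    exact (summable_geometric_of_lt_one hb0.le hb1).sum_le_tsum _ fun _ _ => by positivity
  calc _ ≤ C * b ^ n * (1 + slantDensity p A ω n l z) := hstep n hn l hl z hz
    _ ≤ C * b ^ n * ((1 + (p ^ n₀)⁻¹ * (2 * (k : ℝ) ^ n₀)) * Real.exp (C * (1 - b)⁻¹)) := by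
        gcongr
        exact (hpre n hn).trans (by gcongr)
    _ = _ := by ring

lemma exists_slantDensity_limit {b : ℝ} (hb1 : b < 1)
    (hstep : ∀ ε : ℝ, 0 < ε → ∃ C : ℝ, 0 ≤ C ∧ ∃ n₀ : ℕ, ∀ n ≥ n₀, ∀ l ∈ Icc ε (1 - ε),
      ∀ z ∈ Icc (0 : ℝ) 1,
        |slantDensity p A ω (n + 1) l z - slantDensity p A ω n l z| ≤ C * b ^ n) :
    ∃ g : ℝ → ℝ → ℝ,
      (∀ l ∈ Ioo (0 : ℝ) 1, ∀ z ∈ Icc (0 : ℝ) 1,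
        Tendsto (fun n => slantDensity p A ω n l z) atTop (𝓝 (g l z))) ∧
      ∀ ε : ℝ, 0 < ε → ∃ C : ℝ, 0 ≤ C ∧ ∃ n₀ : ℕ, ∀ n ≥ n₀, ∀ l ∈ Icc ε (1 - ε),
        ∀ z ∈ Icc (0 : ℝ) 1, |slantDensity p A ω n l z - g l z| ≤ C * b ^ n := by
  have key {C : ℝ} {n₀ : ℕ} {l z : ℝ} (hs : ∀ n ≥ n₀,
      |slantDensity p A ω (n + 1) l z - slantDensity p A ω n l z| ≤ C * b ^ n) (m : ℕ)
      (hm : n₀ ≤ m) (n : ℕ) : dist (slantDensity p A ω (n + m) l z)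
        (slantDensity p A ω (n + 1 + m) l z) ≤ C * b ^ m * b ^ n := by
    rw [dist_comm, Real.dist_eq, show n + 1 + m = n + m + 1 by ring]
    refine (hs (n + m) (by omega)).trans (le_of_eq ?_)
    ring
  have hconv : ∀ l ∈ Ioo (0 : ℝ) 1, ∀ z ∈ Icc (0 : ℝ) 1,
      ∃ y, Tendsto (fun n => slantDensity p A ω n l z) atTop (𝓝 y) := by
    intro l hl z hz
    -- The limit is defined pointwise with a margin adapted to `l`, so one `g` serves every `ε`.
    obtain ⟨C, -, n₀, hs⟩ := hstep (min l (1 - l)) (lt_min hl.1 (by linarith [hl.2]))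
    have hl' : l ∈ Icc (min l (1 - l)) (1 - min l (1 - l)) :=
      ⟨min_le_left _ _, by linarith [min_le_right l (1 - l)]⟩
    obtain ⟨y, hy⟩ := cauchySeq_tendsto_of_complete (cauchySeq_of_le_geometric b _ hb1
      (key (fun n hn => hs n hn l hl' z hz) n₀ le_rfl))
    exact ⟨y, (tendsto_add_atTop_iff_nat n₀).1 hy⟩
  choose! g hg using hconv
  refine ⟨g, hg, fun ε hε => ?_⟩
  obtain ⟨C, hC, n₀, hs⟩ := hstep ε hε
  refine ⟨C / (1 - b), div_nonneg hC (by linarith), n₀, fun n hn l hl z hz => ?_⟩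
  have hlim := (tendsto_add_atTop_iff_nat n).2
    (hg l ⟨hε.trans_le hl.1, by linarith [hl.2]⟩ z hz)
  have := dist_le_of_le_geometric_of_tendsto b _ hb1
    (key (fun n hn => hs n hn l hl z hz) n hn) hlim 0
  rw [Real.dist_eq, Nat.zero_add, pow_zero, mul_one] at this
  exact this.trans (le_of_eq (by ring))

/-- At level `m = N / 4` the Lipschitz bound `k^(3m)` against a distance `k^(-N) ≤ k^(-4m)` leaves
`k^(-m) ≤ b^m`, the order of the approximation error. -/
lemma abs_limit_sub_le (hk : 0 < k) (hp : 0 < p) (hkp : 1 < k * p) {b : ℝ}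
    (hbk : (k : ℝ)⁻¹ ≤ b) {g : ℝ → ℝ → ℝ} {ε : ℝ} (hε : 0 < ε) {C : ℝ} {n₀ : ℕ}
    (hg : ∀ n ≥ n₀, ∀ l ∈ Icc ε (1 - ε), ∀ z ∈ Icc (0 : ℝ) 1,
      |slantDensity p A ω n l z - g l z| ≤ C * b ^ n) {N : ℕ} (hN : 4 * n₀ ≤ N) {l z z' : ℝ}
    (hl : l ∈ Icc ε (1 - ε)) (hz : z ∈ Icc (0 : ℝ) 1) (hz' : z' ∈ Icc (0 : ℝ) 1)
    (hzz : |z - z'| ≤ ((k : ℝ) ^ N)⁻¹) :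
    |g l z - g l z'| ≤ (2 * C + 4 / ε ^ 2) * b ^ (N / 4) := by
  have hk' : (1 : ℝ) ≤ k := by exact_mod_cast hk
  have h1 := hg (N / 4) (by omega) l hl z hz
  have h2 := hg (N / 4) (by omega) l hl z' hz'
  have h3 := abs_slantDensity_sub_le (A := A) (ω := ω) hk hp hkp hε hl hl hz'
    (d := ((k : ℝ) ^ N)⁻¹) (by simp) hzz (N / 4)
  have h4 : (k : ℝ) ^ (3 * (N / 4)) * (4 * ((k : ℝ) ^ N)⁻¹ / ε ^ 2) ≤
      4 / ε ^ 2 * b ^ (N / 4) := by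
    have h5 : ((k : ℝ) ^ N)⁻¹ ≤ ((k : ℝ) ^ (4 * (N / 4)))⁻¹ := by
      gcongr
      omega
    calc _ ≤ (k : ℝ) ^ (3 * (N / 4)) * (4 * ((k : ℝ) ^ (4 * (N / 4)))⁻¹ / ε ^ 2) := by gcongr
      _ = 4 / ε ^ 2 * ((k : ℝ)⁻¹) ^ (N / 4) := by
        rw [show 4 * (N / 4) = 3 * (N / 4) + N / 4 by ring, pow_add, inv_pow]
        field_simp
      _ ≤ _ := by gcongr
  rw [abs_le] at *
  constructor <;> linarith

end Deterministic

/-! ### Back to angles and the diagonal -/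

lemma linePoint_eq_slantPoint {θ : ℝ} (h : 0 < Real.cos θ + Real.sin θ) (x t : ℝ) :
    linePoint θ (diagScale θ * x) t =
      slantPoint (Real.cos θ / (Real.cos θ + Real.sin θ)) (x / √2)
        (-(Real.cos θ + Real.sin θ) * t +
          (Real.cos θ + Real.sin θ) * (Real.cos θ - Real.sin θ) * (x / √2)) := by
  have h1 := Real.sin_sq_add_cos_sq θ
  have hz : diagScale θ * x = (Real.cos θ + Real.sin θ) * (x / √2) := by
    rw [diagScale]; ring
  rw [linePoint, slantPoint, hz]
  generalize x / √2 = z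
  generalize Real.cos θ = c at *
  generalize Real.sin θ = s at *
  have hl : 1 - c / (c + s) = s / (c + s) := by field_simp; ring
  rw [hl]
  ext
  · have : z + s / (c + s) * (-(c + s) * t + (c + s) * (c - s) * z) =
        z + s * (-t + (c - s) * z) := by field_simp
    simp only [this]
    linear_combination z * h1
  · have : z - c / (c + s) * (-(c + s) * t + (c + s) * (c - s) * z) =
        z - c * (-t + (c - s) * z) := by field_simp
    simp only [this]
    linear_combination z * h1

/-- The affine change of parameter contributes `(cos θ + sin θ)⁻¹`, which cancels against `diagScale
θ`; the remaining factor does not depend on `θ`. -/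
lemma diagDensity_eq {Ω : Type*} {k : ℕ} (hk : 0 < k) {p : ℝ} {A : Node k → Set Ω} {ω : Ω}
    {θ : ℝ} (hc : 0 < Real.cos θ) (hs : 0 < Real.sin θ) (n : ℕ) (x : ℝ) :
    diagDensity p A ω n θ x = (√2)⁻¹ *
      slantDensity p A ω n (Real.cos θ / (Real.cos θ + Real.sin θ)) (x / √2) := by
  have h : 0 < Real.cos θ + Real.sin θ := by linarith
  have hset : {t : ℝ | linePoint θ (diagScale θ * x) t ∈ approx A ω n} =
      (-(Real.cos θ + Real.sin θ) * ·) ⁻¹' ((· +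
        (Real.cos θ + Real.sin θ) * (Real.cos θ - Real.sin θ) * (x / √2)) ⁻¹'
          {u : ℝ | slantPoint (Real.cos θ / (Real.cos θ + Real.sin θ)) (x / √2) u ∈
            ⋃ w ∈ retained A ω n, kSquare w}) := by
    ext t
    simp only [mem_ofPred_eq, mem_preimage, linePoint_eq_slantPoint h, approx]
  rw [diagDensity, density, hset, Real.volume_preimage_mul_left (neg_ne_zero.2 h.ne'),
    measure_preimage_add_right, ENNReal.toReal_mul, ENNReal.toReal_ofReal (abs_nonneg _),
    ← measureReal_def, volume_real_biUnion_kSquare hk (by positivity)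
      ((div_lt_one h).2 (by linarith)), slantDensity, inv_neg, abs_neg,
    abs_of_pos (inv_pos.2 h), diagScale]
  field_simp

lemma cos_div_mem_Ioo {θ : ℝ} (hθ : θ ∈ Ioo 0 (Real.pi / 2)) :
    0 < Real.cos θ ∧ 0 < Real.sin θ ∧
      Real.cos θ / (Real.cos θ + Real.sin θ) ∈ Ioo (0 : ℝ) 1 := by
  have hc : 0 < Real.cos θ := Real.cos_pos_of_mem_Ioo ⟨by linarith [hθ.1, Real.pi_pos], hθ.2⟩
  have hs : 0 < Real.sin θ := Real.sin_pos_of_pos_of_lt_pi hθ.1 (by linarith [hθ.2, Real.pi_pos])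
  exact ⟨hc, hs, by positivity, (div_lt_one (by positivity)).2 (by linarith)⟩

lemma exists_cos_div_mem_Icc {δ : ℝ} (hδ : 0 < δ) : ∃ ε : ℝ, 0 < ε ∧
    ∀ θ ∈ Icc δ (Real.pi / 2 - δ),
      Real.cos θ / (Real.cos θ + Real.sin θ) ∈ Icc ε (1 - ε) := by
  have hδ' : 0 < min δ 1 := lt_min hδ one_pos
  have hπ := Real.pi_gt_three
  have hδ1 := min_le_right δ 1
  have hδ2 := min_le_left δ 1
  -- Both `sin θ` and `cos θ` are at least `sin (min δ 1)`, and their sum is at most `2`; the cap at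
  -- `1` keeps the sine positive for large `δ`.
  refine ⟨Real.sin (min δ 1) / 2,
    half_pos (Real.sin_pos_of_pos_of_lt_pi hδ' (by linarith)), fun θ hθ => ?_⟩
  obtain ⟨hc, hs, -⟩ := cos_div_mem_Ioo (θ := θ) ⟨by linarith [hθ.1], by linarith [hθ.2]⟩
  have h1 : Real.sin (min δ 1) ≤ Real.sin θ :=
    Real.sin_le_sin_of_le_of_le_pi_div_two (by linarith) (by linarith [hθ.2])
      (by linarith [hθ.1])
  have h2 : Real.sin (min δ 1) ≤ Real.cos θ := by
    rw [← Real.sin_pi_div_two_sub]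
    exact Real.sin_le_sin_of_le_of_le_pi_div_two (by linarith) (by linarith [hθ.1])
      (by linarith [hθ.2])
  have hc1 := Real.cos_le_one θ
  have hs1 := Real.sin_le_one θ
  have h : 0 < Real.cos θ + Real.sin θ := by linarith
  constructor
  · rw [le_div_iff₀ h]
    nlinarith
  · rw [div_le_iff₀ h]
    nlinarith

lemma exists_rate {k : ℕ} (hk : 2 ≤ k) {p : ℝ} (hkp : 1 < (k : ℝ) * p) :
    ∃ b : ℝ, 0 < b ∧ b < 1 ∧ (k : ℝ)⁻¹ ≤ b ∧ 1 < b ^ 2 * (k * p) := by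
  have hk' : (2 : ℝ) ≤ k := by exact_mod_cast hk
  have h1 : √((k * p)⁻¹) < 1 := by
    rw [Real.sqrt_lt' one_pos, one_pow]
    exact inv_lt_one_of_one_lt₀ hkp
  have h2 : (k : ℝ)⁻¹ < 1 := inv_lt_one_of_one_lt₀ (by linarith)
  obtain ⟨b, hb, hb1⟩ := exists_between (max_lt h1 h2)
  obtain ⟨hb2, hb3⟩ := max_lt_iff.1 hb
  have hb0 : 0 < b := lt_trans (by positivity) hb3
  refine ⟨b, hb0, hb1, hb3.le, ?_⟩
  rw [Real.sqrt_lt' hb0] at hb2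
  exact (inv_lt_iff_one_lt_mul₀ (by linarith)).1 hb2

lemma div_sqrt_two_mem {x : ℝ} (hx : x ∈ commonRange) : x / √2 ∈ Icc (0 : ℝ) 1 :=
  ⟨div_nonneg hx.1 (Real.sqrt_nonneg _), (div_le_one (by positivity)).2 hx.2⟩

end Percolation

/-! ### Assembly -/

theorem proposition5p1 (k : ℕ) (hk : 2 ≤ k) (p : ℝ) (hp0 : 0 < p) (hp1 : p < 1)
    (hkp : 1 < (k : ℝ) * p) :
    ∃ b : ℝ, 0 < b ∧ b < 1 ∧
      ∀ (Ω : Type*) [MeasurableSpace Ω] (P : Measure Ω) [IsProbabilityMeasure P]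
        (A : Percolation.Node k → Set Ω), Percolation.IsMarking P k p A →
        ∀ᵐ ω ∂P, ∃ Y : ℝ → ℝ → ℝ,
          (∀ θ ∈ Ioo 0 (Real.pi / 2), ∀ x ∈ Percolation.commonRange,
            Tendsto (fun m : ℕ => Percolation.diagDensity p A ω m θ x) atTop (𝓝 (Y θ x))) ∧
          ∀ δ : ℝ, 0 < δ →
            TendstoUniformlyOn
              (fun (m : ℕ) (q : ℝ × ℝ) => Percolation.diagDensity p A ω m q.1 q.2)
              (fun q : ℝ × ℝ => Y q.1 q.2) atTop
              (Icc δ (Real.pi / 2 - δ) ×ˢ Percolation.commonRange) ∧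
            ∃ C₃ : ℝ, 0 < C₃ ∧ ∃ N₂ : ℕ, 0 < N₂ ∧ ∀ N : ℕ, N₂ < N →
              ∀ x ∈ Percolation.commonRange, ∀ y ∈ Percolation.commonRange,
                |x - y| < (k : ℝ) ^ (-(N : ℤ) - 1) →
                ∀ θ ∈ Icc δ (Real.pi / 2 - δ), |Y θ x - Y θ y| < C₃ * b ^ N := by
  have hk0 : 0 < k := by omega
  have hk1 : (1 : ℝ) ≤ k := by exact_mod_cast hk0
  obtain ⟨b, hb0, hb1, hbk, hbkp⟩ := Percolation.exists_rate hk hkp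
  -- The fourth root turns the modulus `b ^ (N / 4)` into a rate in `N`.
  set r : ℝ := √(√b) with hr
  have hr0 : 0 < r := by positivity
  have hr4 : r ^ 4 = b := by
    rw [hr, show (4 : ℕ) = 2 * 2 from rfl, pow_mul, Real.sq_sqrt (by positivity),
      Real.sq_sqrt hb0.le]
  have hr1 : r < 1 := by
    by_contra! hcon
    linarith [one_le_pow₀ hcon (n := 4)]
  refine ⟨r, hr0, hr1, fun Ω _ P _ A hA => ?_⟩
  filter_upwards [hA.ae_eventually_net hk0 hp0 hb0 hbkp (K := k ^ 4) (by positivity)] with ω hω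
  obtain ⟨g, hg, hgε⟩ := Percolation.exists_slantDensity_limit (p := p) (A := A) (ω := ω) hb1
    fun ε hε => by
      obtain ⟨C, hC, n₀, hs⟩ := Percolation.exists_abs_step_le_mul hk hp0 hkp hb1.le hbk hω hε
      obtain ⟨C', hC', hs'⟩ := Percolation.exists_abs_step_le hk hp0 hb0 hb1 hε hC hs
      exact ⟨C', hC', n₀, hs'⟩
  have h2 : (√2)⁻¹ ≤ 1 := inv_le_one_of_one_le₀ (by rw [Real.one_le_sqrt]; norm_num)
  have h2' : 0 < (√2)⁻¹ := by positivity
  refine ⟨fun θ x => (√2)⁻¹ * g (Real.cos θ / (Real.cos θ + Real.sin θ)) (x / √2), ?_, ?_⟩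
  · intro θ hθ x hx
    obtain ⟨hc, hs, hl⟩ := Percolation.cos_div_mem_Ioo hθ
    simp only [Percolation.diagDensity_eq hk0 hc hs]
    exact (hg _ hl _ (Percolation.div_sqrt_two_mem hx)).const_mul _
  · intro δ hδ
    obtain ⟨ε, hε, hεθ⟩ := Percolation.exists_cos_div_mem_Icc hδ
    obtain ⟨C, hC, n₀, hC'⟩ := hgε ε hε
    refine ⟨?_, ?_⟩
    · rw [Metric.tendstoUniformlyOn_iff]
      intro η hη
      have hlim : Tendsto (fun n : ℕ => C * b ^ n) atTop (𝓝 0) := by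
        simpa using (tendsto_pow_atTop_nhds_zero_of_lt_one hb0.le hb1).const_mul C
      filter_upwards [hlim.eventually_lt_const hη, eventually_ge_atTop n₀] with n hn hn₀
      rintro ⟨θ, x⟩ ⟨hθ, hx⟩
      obtain ⟨hc, hs, -⟩ := Percolation.cos_div_mem_Ioo (θ := θ)
        ⟨hδ.trans_le hθ.1, by linarith [hθ.2]⟩
      rw [dist_comm, Real.dist_eq, Percolation.diagDensity_eq hk0 hc hs, ← mul_sub, abs_mul,
        abs_of_pos h2']
      exact ((mul_le_of_le_one_left (abs_nonneg _) h2).trans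
        (hC' n hn₀ _ (hεθ θ hθ) _ (Percolation.div_sqrt_two_mem hx))).trans_lt hn
    -- The `+ 1` makes the inequality strict, and `(r ^ 3)⁻¹` pays for the floor, as `N ≤ 4 * (N /
    -- 4) + 3`.
    · refine ⟨(2 * C + 4 / ε ^ 2 + 1) * (r ^ 3)⁻¹, by positivity, 4 * n₀ + 1, by omega,
        fun N hN x hx y hy hxy θ hθ => ?_⟩
      have hxy' : |x / √2 - y / √2| ≤ ((k : ℝ) ^ N)⁻¹ := by
        rw [← sub_div, div_eq_mul_inv, abs_mul, abs_of_pos h2']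
        refine (mul_le_of_le_one_right (abs_nonneg _) h2).trans (hxy.le.trans ?_)
        rw [← zpow_natCast, ← zpow_neg]
        exact zpow_le_zpow_right₀ hk1 (by omega)
      have hmain := Percolation.abs_limit_sub_le hk0 hp0 hkp hbk hε hC'
        (by omega : 4 * n₀ ≤ N) (hεθ θ hθ) (Percolation.div_sqrt_two_mem hx)
        (Percolation.div_sqrt_two_mem hy) hxy'
      have hrN : b ^ (N / 4) ≤ (r ^ 3)⁻¹ * r ^ N := by
        rw [← hr4, ← pow_mul, le_inv_mul_iff₀ (by positivity), ← pow_add]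
        exact pow_le_pow_of_le_one hr0.le hr1.le (by omega)
      rw [← mul_sub, abs_mul, abs_of_pos h2', mul_assoc]
      calc _ ≤ (2 * C + 4 / ε ^ 2) * b ^ (N / 4) :=
            (mul_le_of_le_one_left (abs_nonneg _) h2).trans hmain
        _ < (2 * C + 4 / ε ^ 2 + 1) * b ^ (N / 4) :=
            mul_lt_mul_of_pos_right (lt_add_one _) (by positivity)
        _ ≤ _ := by gcongr
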